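/- Setting. Let $P=(p_{ij})$ be the transition matrix of a $K$-state Markov chain (the channel of one user), let $(p^s_k)_{k}$ be its steady-state distribution, and put $\vec\pi_j^\tau=\vec e_jP^\tau$ for $j\in\{1,\dots,K\}$, $\tau\ge1$. The belief states are the pairs $(j,\tau)$, written $\vec\pi_j^\tau$. Consider the following single-arm Markov decision process on them. Under the passive action ($a=0$) the state $\vec\pi_j^\tau$ moves to $\vec\pi_j^{\tau+1}$ and the reward is $R(\vec\pi_j^\tau,0)+W$, where $W\in\mathbb R$ is the subsidy for passivity; under the active action ($a=1$) the next state is $\vec\pi_k^1$ with probability $p_k^s$, and the reward is the constant $R^1$. Assume $R^1\ge R(\vec\pi_j^\tau,0)\ge R(\vec\pi_j^{\tau'},0)$ for all $j$ and all $\tau'\ge\tau\ge1$. The average-reward optimality equation is $$V(\vec\pi_j^\tau)+g=\max\Big\{R(\vec\pi_j^\tau,0)+W+V(\vec\pi_j^{\tau+1}),\ R^1+\sum_{k=1}^Kp_k^sV(\vec\pi_k^1)\Big\},$$ with $g$ the optimal long-run expected average reward (from every initial state) and $V$ bounded. Whittle's index $W(\vec\pi_j^\tau)$ is the smallest $W$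 for which both actions are optimal in $\vec\pi_j^\tau$, that is, for which this equation has a solution such that the two terms of the maximum are equal at $\vec\pi_j^\tau$; it is $+\infty$ if there is no such $W$. Write $\omega_k=p_k^s$. Let $\vec\Gamma^{-1}=\vec 0$ and, for $i\ge0$, let $u^i$ be any element of $\operatorname{argmax}_{u\in\{1,\dots,K\}}R(\vec\pi_u^{\Gamma_u^{i-1}+1},0)$ and $\Gamma^i_k=\#\{r\in\{0,\dots,i\}:u^r=k\}$ for all $k$. Statement. (1) For every $j\ge0$, Whittle's index of $\vec\pi_{u^j}^{\Gamma^j_{u^j}}$ exists, is finite, and equals $$W\big(\vec\pi_{u^j}^{\Gamma^j_{u^j}}\big)=R^1+\sum_{k=1}^K\sum_{r=1}^{\Gamma_k^{j-1}}R(\vec\pi_k^r,0)\,\omega_k-R\big(\vec\pi_{u^j}^{\Gamma^j_{u^j}},0\big)\sum_{k=1}^K(\Gamma_k^{j-1}+1)\,\omega_k .$$ (2) For every $k$, $W(\vec\pi_k^\tau)$ is non-decreasing in $\tau$. (3) For $\vec\Gamma\in\{0,1,2,\dots\}^K$, the threshold policy $\vec\Gamma$ (active in $\vec\pi_j^\tau$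 if and only if $\tau>\Gamma_j$) has exactly one steady-state law $\alpha^{\vec\Gamma}$. Let $E(\vec\Gamma)$ be its mean steady-state reward for $W=0$, let $D(\vec\Gamma)=\sum_k\sum_{r=1}^{\Gamma_k}\alpha^{\vec\Gamma}(\vec\pi_k^r)$, and for $\vec\Gamma'>\vec\Gamma$ (that is, $\Gamma'_k\ge\Gamma_k$ for all $k$ and $\vec\Gamma'\ne\vec\Gamma$) put $\rho(\vec\Gamma,\vec\Gamma')=\frac{E(\vec\Gamma)-E(\vec\Gamma')}{D(\vec\Gamma')-D(\vec\Gamma)}$. Assume that $p_k^s>0$ for all $k$. If $\vec\Gamma'$ minimizes $\rho(\vec\Gamma,\cdot)$ over all vectors greater than $\vec\Gamma$, and $\sum_k\Gamma'_k=\sum_k\Gamma_k+1$, then, with $u$ the index such that $\Gamma'_u=\Gamma_u+1$, $$\inf_{\vec\Gamma''>\vec\Gamma}\rho(\vec\Gamma,\vec\Gamma'')=R^1+\sum_{k=1}^K\sum_{r=1}^{\Gamma_k}R(\vec\pi_k^r,0)\,\omega_k-R(\vec\pi_u^{\Gamma'_u},0)\sum_{k=1}^K(\Gamma_k+1)\,\omega_k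 .$$ Moreover, for every $j\ge0$ the vector $\vec\Gamma^j$ is a minimizer of $\rho(\vec\Gamma^{j-1},\cdot)$ over all vectors greater than $\vec\Gamma^{j-1}$, and the minimum is the value displayed in (1). -/

import Mathlib

open Filter

noncomputable section

/-- A single arm (user): a `K`-state channel with transition matrix `P`, a steady-state law `ps`
of that channel, the average immediate reward `R1` under the active action and the average
immediate reward `R0 b` under the passive action when the belief vector is `b`. -/
structure SingleArm (K : ℕ) where
  P : Matrix (Fin K) (Fin K) ℝ
  P_stochastic : P ∈ Matrix.rowStochastic ℝ (Fin K)
  ps : Fin K → ℝ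
  ps_nonneg : ∀ k, 0 ≤ ps k
  ps_sum : ∑ k, ps k = 1
  ps_stationary : Matrix.vecMul ps P = ps
  R1 : ℝ
  R0 : (Fin K → ℝ) → ℝ

/-- The state `(j, τ)`, with `τ ≥ 1`: the channel was last observed `τ` slots ago, in state `j`. -/
abbrev BState (K : ℕ) : Type := Fin K × ℕ+

namespace SingleArm

variable {K : ℕ}

/-- The belief vector `e_j P ^ τ`. -/
def belief (A : SingleArm K) (j : Fin K) (τ : ℕ) : Fin K → ℝ :=
  Matrix.vecMul (Pi.single j 1) (A.P ^ τ)

/-- The average passive reward `R(π_j^τ, 0)`; only `τ ≥ 1` is ever used. -/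
def passiveReward (A : SingleArm K) (j : Fin K) (τ : ℕ) : ℝ := A.R0 (A.belief j τ)

/-- Outdated information is worth less:
`R¹ ≥ R(π_j^τ, 0) ≥ R(π_j^τ', 0)` for all `τ' ≥ τ ≥ 1`. -/
def RewardMonotone (A : SingleArm K) : Prop :=
  ∀ (j : Fin K) (τ τ' : ℕ), 1 ≤ τ → τ ≤ τ' →
    A.passiveReward j τ ≤ A.R1 ∧ A.passiveReward j τ' ≤ A.passiveReward j τ

/-- Transition probabilities of the approximate model. Action `true` is active (the next state is
`(k, 1)` with probability `ps k`), action `false` is passive (`(j, τ)` moves to `(j, τ + 1)`). -/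
def q (A : SingleArm K) (a : Bool) (s s' : BState K) : ℝ :=
  if a then (if s'.2 = 1 then A.ps s'.1 else 0)
  else (if s' = (s.1, s.2 + 1) then 1 else 0)

/-- Expectation of `f` at the next state. -/
def expNext (A : SingleArm K) (a : Bool) (f : BState K → ℝ) (s : BState K) : ℝ :=
  ∑' s', A.q a s s' * f s'

theorem expNext_passive (A : SingleArm K) (f : BState K → ℝ) (s : BState K) :
    A.expNext false f s = f (s.1, s.2 + 1) := by
  unfold expNext
  rw [tsum_eq_single (s.1, s.2 + 1)]
  · simp [q]
  · intro s' h
    simp [q, h]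

theorem expNext_active (A : SingleArm K) (f : BState K → ℝ) (s : BState K) :
    A.expNext true f s = ∑ k, A.ps k * f (k, 1) := by
  unfold expNext
  rw [tsum_eq_sum (s := Finset.univ.image (fun k : Fin K => ((k, 1) : BState K)))]
  · rw [Finset.sum_image (by intro a _ b _ h; exact (Prod.mk.inj h).1)]
    simp [q]
  · rintro ⟨k, t⟩ h
    have ht : t ≠ 1 := by
      rintro rfl
      exact h (Finset.mem_image.2 ⟨k, Finset.mem_univ _, rfl⟩)
    simp [q, ht]

/-- Immediate reward with subsidy `W` for passivity. -/
def reward (A : SingleArm K) (W : ℝ) (a : Bool) (s : BState K) : ℝ :=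
  if a then A.R1 else A.passiveReward s.1 s.2 + W

/-- Expected reward in slot `t` (counted from `0`) under policy `φ`, started in `s`. -/
def expReward (A : SingleArm K) (W : ℝ) (φ : BState K → Bool) : ℕ → BState K → ℝ
  | 0, s => A.reward W (φ s) s
  | t + 1, s => A.expNext (φ s) (expReward A W φ t) s

/-- Long-run expected average reward of policy `φ`, started in `s`. It is an extended real number,
since the passive rewards need not be bounded below. -/
def avgReward (A : SingleArm K) (W : ℝ) (φ : BState K → Bool) (s : BState K) : EReal :=
  liminf (fun T : ℕ => (((∑ t ∈ Finset.range T, A.expReward W φ t s) / (T : ℝ) : ℝ) : EReal)) atTop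

/-- Optimal long-run expected average reward from `s`. -/
def optAvgReward (A : SingleArm K) (W : ℝ) (s : BState K) : EReal :=
  ⨆ φ : BState K → Bool, A.avgReward W φ s

/-- Right-hand side of the average-reward optimality equation, for the action `a`. -/
def actionValue (A : SingleArm K) (W : ℝ) (V : BState K → ℝ) (a : Bool) (s : BState K) : ℝ :=
  A.reward W a s + A.expNext a V s

/-- `(g, V)` solves the average-reward optimality equation with subsidy `W`: `g` is the optimal
average reward from every state, and `V` is a bounded relative value function. -/
def SolvesOptimality (A : SingleArm K) (W g : ℝ) (V : BState K → ℝ) : Prop :=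
  (∀ s, A.optAvgReward W s = (g : EReal)) ∧
  (∃ C : ℝ, ∀ s, |V s| ≤ C) ∧
  ∀ s, V s + g = max (A.actionValue W V false s) (A.actionValue W V true s)

/-- With subsidy `W`, both actions are optimal in state `s`. -/
def Indifferent (A : SingleArm K) (W : ℝ) (s : BState K) : Prop :=
  ∃ (g : ℝ) (V : BState K → ℝ), A.SolvesOptimality W g V ∧
    A.actionValue W V false s = A.actionValue W V true s

/-- Whittle's index: the smallest subsidy that makes both actions optimal in `s`
(`⊤` if there is none). -/
def whittleIndex (A : SingleArm K) (s : BState K) : EReal :=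
  sInf ((fun W : ℝ => (W : EReal)) '' {W | A.Indifferent W s})

/-- The threshold policy `Γ`: active in `(j, τ)` iff `τ > Γ j`. -/
def thresholdPolicy (Γ : Fin K → ℕ) (s : BState K) : Bool := decide (Γ s.1 < (s.2 : ℕ))

/-- `α` is a steady-state law of the chain that is driven by the threshold policy `Γ`. -/
def IsSteadyState (A : SingleArm K) (Γ : Fin K → ℕ) (α : BState K → ℝ) : Prop :=
  (∀ s, 0 ≤ α s) ∧ HasSum α 1 ∧
  ∀ s', HasSum (fun s => α s * A.q (thresholdPolicy Γ s) s s') (α s')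

/-- Mean steady-state reward (without subsidy) of the threshold policy `Γ`, for its steady-state
law `α`. -/
def meanReward (A : SingleArm K) (Γ : Fin K → ℕ) (α : BState K → ℝ) : ℝ :=
  ∑' s, α s * A.reward 0 (thresholdPolicy Γ s) s

/-- Steady-state probability `∑_k ∑_{r = 1}^{Γ_k} α(π_k^r)` of being passive. -/
def passiveProb (Γ : Fin K → ℕ) (α : BState K → ℝ) : ℝ :=
  ∑ k, ∑ r ∈ Finset.range (Γ k), α (k, r.succPNat)

/-- The subsidy at which the threshold policies `Γ` and `Γ'` have the same average reward. Here
`α Γ` is the steady-state law of the threshold policy `Γ`. -/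
def stepRatio (A : SingleArm K) (α : (Fin K → ℕ) → BState K → ℝ) (Γ Γ' : Fin K → ℕ) : ℝ :=
  (A.meanReward Γ (α Γ) - A.meanReward Γ' (α Γ')) /
    (passiveProb Γ' (α Γ') - passiveProb Γ (α Γ))

/-- The numbers whose infimum is the value `W_i` of the step that starts from the threshold vector
`Γ = Γ^{i-1}`. In the order of `Fin K → ℕ`, `Γ < Γ'` means `Γ ≤ Γ'` in every entry and `Γ ≠ Γ'`. -/
def stepValues (A : SingleArm K) (α : (Fin K → ℕ) → BState K → ℝ) (Γ : Fin K → ℕ) : Set ℝ :=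
  A.stepRatio α Γ '' {Γ' | Γ < Γ'}

/-- `R¹ + ∑_k ∑_{r = 1}^{Γ_k} R(π_k^r, 0) ω_k - R(π_v^τ, 0) ∑_k (Γ_k + 1) ω_k`, with
`ω_k = p_k^s`. -/
def closedForm (A : SingleArm K) (Γ : Fin K → ℕ) (v : Fin K) (τ : ℕ) : ℝ :=
  A.R1 + ∑ k, ∑ r ∈ Finset.Icc 1 (Γ k), A.passiveReward k r * A.ps k
    - A.passiveReward v τ * ∑ k, ((Γ k : ℝ) + 1) * A.ps k

/-- `countBefore u n k` is the number of `r < n` with `u r = k`. So `Γ^i = countBefore u (i + 1)`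
and `Γ^{i-1} = countBefore u i`, with `Γ^{-1} = 0`. -/
def countBefore (u : ℕ → Fin K) (n : ℕ) (k : Fin K) : ℕ :=
  ((Finset.range n).filter (fun r => u r = k)).card

/-- For every `i ≥ 0`, `u^i` is a maximizer of `v ↦ R(π_v^{Γ^{i-1}_v + 1}, 0)`
(any one of them, if there are several). -/
def IsGreedy (A : SingleArm K) (u : ℕ → Fin K) : Prop :=
  ∀ (i : ℕ) (v : Fin K), A.passiveReward v (countBefore u i v + 1) ≤
    A.passiveReward (u i) (countBefore u i (u i) + 1)

end SingleArm

end

/-! Put `h = g - W`, and measure the relative value of a state from the value at which the active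
action is optimal. The optimality equation then is the stopping equation
`U s = (R s - h + U s⁺)⁺`, where `s⁺` follows `s` under the passive action. Its least nonnegative
solution is the sum of the positive parts of `R - h` along the passive path; it fixes the least
subsidy that belongs to the level `h`. If both actions are optimal in `s`, then `h = R s`, since
otherwise `U` would grow linearly along the passive path.

A threshold policy `Γ` runs through cycles, each ending with an active slot. With the mean length
`L Γ` and the mean reward `C Γ` of a cycle, `E Γ = C Γ / L Γ` and `D Γ = 1 - 1 / L Γ`, so that
`ρ(Γ, Γ') = C Γ - m * L Γ`, where `m` is the weighted mean of the passive rewards that `Γ'` collects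
and `Γ` does not. It is smallest when the best such reward alone is added. The greedy vector `Γ`
separates the passive rewards at the level `h` of the next one, and then the least subsidy for `h`
is `C Γ - h * L Γ` as well.
-/

theorem eq_add_single_of_sum_eq_succ {ι : Type*} [Fintype ι] [DecidableEq ι] {Γ Γ' : ι → ℕ}
    {v : ι} (hle : Γ ≤ Γ') (hsum : ∑ k, Γ' k = ∑ k, Γ k + 1) (hv : Γ' v = Γ v + 1) :
    Γ' = Γ + Pi.single v 1 := by
  have hle' : ∀ k ∈ Finset.univ, (Γ + Pi.single v 1 : ι → ℕ) k ≤ Γ' k := by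
    intro k _
    rcases eq_or_ne k v with rfl | hk
    · simp [hv]
    · simpa [hk] using hle k
  have hsum' : ∑ k, (Γ + Pi.single v 1 : ι → ℕ) k = ∑ k, Γ' k := by
    simp [Finset.sum_add_distrib, hsum]
  funext k
  exact ((Finset.sum_eq_sum_iff_of_le hle').1 hsum' k (Finset.mem_univ k)).symm

theorem hasSum_prod_pnat_of_eq_zero {ι M : Type*} [Fintype ι] [AddCommMonoid M]
    [TopologicalSpace M] {f : ι × ℕ+ → M} {N : ι → ℕ}
    (hf : ∀ k r, N k ≤ r → f (k, r.succPNat) = 0) :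
    HasSum f (∑ k, ∑ r ∈ Finset.range (N k), f (k, r.succPNat)) := by
  let e : (Σ _ : ι, ℕ) ≃ ι × ℕ+ :=
    (Equiv.sigmaEquivProd ι ℕ).trans ((Equiv.refl ι).prodCongr Equiv.pnatEquivNat.symm)
  have hsum : HasSum (f ∘ e)
      (∑ x ∈ Finset.univ.sigma fun k => Finset.range (N k), f (x.1, x.2.succPNat)) := by
    refine hasSum_sum_of_ne_finset_zero ?_
    rintro ⟨k, r⟩ hr
    exact hf k r (by simpa using hr)
  rw [Finset.sum_sigma] at hsum
  exact e.hasSum_iff.1 hsum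

section StoppingEquation

variable {x U : ℕ → ℝ}

theorem tsum_posPart_eq_posPart_add (hx : Antitone x) (hs : Summable fun i => (x i)⁺) :
    ∑' i, (x i)⁺ = (x 0 + ∑' i, (x (i + 1))⁺)⁺ := by
  rcases le_total (x 0) 0 with h0 | h0
  · have hzero : ∀ i, (x i)⁺ = 0 := fun i => posPart_eq_zero.2 ((hx i.zero_le).trans h0)
    simp only [hzero, tsum_zero, add_zero]
  · have htail : 0 ≤ ∑' i, (x (i + 1))⁺ := tsum_nonneg fun _ => posPart_nonneg _
    rw [hs.tsum_eq_zero_add, posPart_of_nonneg h0, posPart_of_nonneg (add_nonneg h0 htail)]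

theorem sum_range_posPart_le (hx : Antitone x) (hU : ∀ n, 0 ≤ U n)
    (hstep : ∀ n, x n + U (n + 1) ≤ U n) (m : ℕ) :
    ∑ i ∈ Finset.range m, (x i)⁺ ≤ U 0 := by
  induction m generalizing x U with
  | zero => simpa using hU 0
  | succ m ih =>
    rcases le_total (x 0) 0 with h0 | h0
    · rw [Finset.sum_eq_zero fun i _ => posPart_eq_zero.2 ((hx i.zero_le).trans h0)]
      exact hU 0
    · have htail := ih (x := fun n => x (n + 1)) (U := fun n => U (n + 1))
        (fun _ _ h => hx (Nat.succ_le_succ h)) (fun n => hU (n + 1)) fun n => hstep (n + 1)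
      rw [Finset.sum_range_succ', posPart_of_nonneg h0]
      linarith [hstep 0]

theorem eq_zero_of_add_eq_zero_of_posPart_eq (hx : Antitone x) (hbdd : BddAbove (Set.range U))
    (hU : ∀ n, U n = (x n + U (n + 1))⁺) (h0 : x 0 + U 1 = 0) : x 0 = 0 := by
  have hU1 : 0 ≤ U 1 := (hU 1).symm ▸ posPart_nonneg _
  by_contra hne
  have hneg : 0 < -x 0 := by
    have := lt_of_le_of_ne (by linarith : x 0 ≤ 0) hne
    linarith
  -- While `U` is positive it is not cut off at `0`, so it gains at least `-x 0` in every step.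
  have hgrow : ∀ n : ℕ, ((n + 1 : ℕ) : ℝ) * -x 0 ≤ U (n + 1) := by
    intro n
    induction n with
    | zero =>
      norm_num
      linarith
    | succ n ih =>
      have hpos : 0 < U (n + 1) := lt_of_lt_of_le (by positivity) ih
      have heq : U (n + 1) = x (n + 1) + U (n + 2) :=
        (hU (n + 1)).trans (posPart_eq_of_posPart_pos (hU (n + 1) ▸ hpos))
      have hle := hx (n + 1).zero_le
      push_cast at ih ⊢
      linarith
  obtain ⟨C, hC⟩ := hbdd
  obtain ⟨n, hn⟩ := exists_nat_gt (C / -x 0)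
  rw [div_lt_iff₀ hneg] at hn
  have hle := (hgrow n).trans (hC ⟨n + 1, rfl⟩)
  push_cast at hle
  linarith

end StoppingEquation

section AverageOfPartialSums

variable {S : ℕ → ℝ} {g c : ℝ}

theorem liminf_coe_add_const_div (g c : ℝ) :
    liminf (fun T : ℕ => ((g + c / (T : ℝ) : ℝ) : EReal)) atTop = (g : EReal) := by
  refine Tendsto.liminf_eq ((continuous_coe_real_ereal.tendsto g).comp ?_)
  simpa using (tendsto_const_div_atTop_nhds_zero_nat c).const_add g

theorem liminf_div_le_of_le_mul_add (h : ∀ T : ℕ, S T ≤ T * g + c) :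
    liminf (fun T : ℕ => ((S T / (T : ℝ) : ℝ) : EReal)) atTop ≤ g := by
  rw [← liminf_coe_add_const_div g c]
  refine liminf_le_liminf ?_
  filter_upwards [eventually_gt_atTop 0] with T hT
  have hT' : (0 : ℝ) < T := Nat.cast_pos.2 hT
  rw [EReal.coe_le_coe_iff, div_le_iff₀ hT', add_mul, div_mul_cancel₀ _ hT'.ne', mul_comm g]
  exact h T

theorem le_liminf_div_of_mul_add_le (h : ∀ T : ℕ, T * g + c ≤ S T) :
    g ≤ liminf (fun T : ℕ => ((S T / (T : ℝ) : ℝ) : EReal)) atTop := by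
  rw [← liminf_coe_add_const_div g c]
  refine liminf_le_liminf ?_
  filter_upwards [eventually_gt_atTop 0] with T hT
  have hT' : (0 : ℝ) < T := Nat.cast_pos.2 hT
  rw [EReal.coe_le_coe_iff, le_div_iff₀ hT', add_mul, div_mul_cancel₀ _ hT'.ne', mul_comm g]
  exact h T

end AverageOfPartialSums

namespace SingleArm

section Verification

variable {K : ℕ} (A : SingleArm K) {W g C : ℝ} {V : BState K → ℝ} {φ : BState K → Bool}

theorem sum_expNext (a : Bool) (f : ℕ → BState K → ℝ) (T : ℕ) (s : BState K) :
    ∑ t ∈ Finset.range T, A.expNext a (f t) s =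
      A.expNext a (fun s' => ∑ t ∈ Finset.range T, f t s') s := by
  cases a
  · simp only [expNext_passive]
  · simp only [expNext_active, Finset.mul_sum]
    exact Finset.sum_comm

theorem expNext_mono (a : Bool) : Monotone (A.expNext a) := by
  intro f f' h s
  cases a
  · simpa only [expNext_passive] using h _
  · simp only [expNext_active]
    exact Finset.sum_le_sum fun k _ => mul_le_mul_of_nonneg_left (h _) (A.ps_nonneg k)

theorem expNext_add_const (a : Bool) (f : BState K → ℝ) (c : ℝ) (s : BState K) :
    A.expNext a (fun s' => f s' + c) s = A.expNext a f s + c := by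
  cases a
  · simp only [expNext_passive]
  · simp only [expNext_active, mul_add, Finset.sum_add_distrib, ← Finset.sum_mul, A.ps_sum,
      one_mul]

theorem sum_expReward_succ (W : ℝ) (φ : BState K → Bool) (T : ℕ) (s : BState K) :
    ∑ t ∈ Finset.range (T + 1), A.expReward W φ t s = A.reward W (φ s) s +
      A.expNext (φ s) (fun s' => ∑ t ∈ Finset.range T, A.expReward W φ t s') s := by
  rw [Finset.sum_range_succ', ← sum_expNext, add_comm]
  rfl

theorem sum_expReward_le (hC : ∀ s, C ≤ V s)
    (hV : ∀ s, A.actionValue W V (φ s) s ≤ V s + g) (T : ℕ) (s : BState K) :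
    ∑ t ∈ Finset.range T, A.expReward W φ t s ≤ V s + (T * g - C) := by
  induction T generalizing s with
  | zero => simpa using hC s
  | succ T ih =>
    calc ∑ t ∈ Finset.range (T + 1), A.expReward W φ t s
        ≤ A.reward W (φ s) s + A.expNext (φ s) (fun s' => V s' + (T * g - C)) s := by
          rw [sum_expReward_succ]
          exact add_le_add_right (A.expNext_mono (φ s) ih s) _
      _ = A.actionValue W V (φ s) s + (T * g - C) := by
          rw [expNext_add_const, actionValue, add_assoc]
      _ ≤ V s + ((T + 1 : ℕ) * g - C) := by
          push_cast
          linarith [hV s]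

theorem le_sum_expReward (hC : ∀ s, V s ≤ C)
    (hV : ∀ s, V s + g ≤ A.actionValue W V (φ s) s) (T : ℕ) (s : BState K) :
    V s + (T * g - C) ≤ ∑ t ∈ Finset.range T, A.expReward W φ t s := by
  induction T generalizing s with
  | zero => simpa using hC s
  | succ T ih =>
    calc V s + ((T + 1 : ℕ) * g - C)
        ≤ A.actionValue W V (φ s) s + (T * g - C) := by
          push_cast
          linarith [hV s]
      _ = A.reward W (φ s) s + A.expNext (φ s) (fun s' => V s' + (T * g - C)) s := by
          rw [expNext_add_const, actionValue, add_assoc]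
      _ ≤ ∑ t ∈ Finset.range (T + 1), A.expReward W φ t s := by
          rw [sum_expReward_succ]
          exact add_le_add_right (A.expNext_mono (φ s) ih s) _

theorem avgReward_le (hC : ∀ s, C ≤ V s) (hV : ∀ s, A.actionValue W V (φ s) s ≤ V s + g)
    (s : BState K) : A.avgReward W φ s ≤ g :=
  liminf_div_le_of_le_mul_add (c := V s - C) fun T => by
    linarith [A.sum_expReward_le hC hV T s]

theorem le_avgReward (hC : ∀ s, V s ≤ C) (hV : ∀ s, V s + g ≤ A.actionValue W V (φ s) s)
    (s : BState K) : g ≤ A.avgReward W φ s :=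
  le_liminf_div_of_mul_add_le (c := V s - C) fun T => by
    linarith [A.le_sum_expReward hC hV T s]

theorem optAvgReward_eq (hC : ∀ s, |V s| ≤ C)
    (hV : ∀ s, V s + g = max (A.actionValue W V false s) (A.actionValue W V true s))
    (s : BState K) : A.optAvgReward W s = g := by
  have hle : ∀ a s, A.actionValue W V a s ≤ V s + g := fun a s => by
    rw [hV s]
    cases a
    exacts [le_max_left _ _, le_max_right _ _]
  have hgreedy : ∀ s, ∃ a, V s + g ≤ A.actionValue W V a s := fun s => by
    rcases max_choice (A.actionValue W V false s) (A.actionValue W V true s) with h | h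
    exacts [⟨false, ((hV s).trans h).le⟩, ⟨true, ((hV s).trans h).le⟩]
  choose φ hφ using hgreedy
  exact le_antisymm
    (iSup_le fun ψ => A.avgReward_le (fun s => neg_le_of_abs_le (hC s)) (fun s => hle (ψ s) s) s)
    (le_iSup_of_le φ (A.le_avgReward (fun s => le_of_abs_le (hC s)) hφ s))

end Verification

section OptimalStopping

variable {K : ℕ} {A : SingleArm K} {W g h h' : ℝ} {V : BState K → ℝ} {s : BState K}

/-- The state that follows `s` under the passive action. -/
def passiveNext (s : BState K) : BState K := (s.1, s.2 + 1)

/-- The reward of the `i`-th passive slot from state `s` on, in excess of the level `h`. -/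
def surplus (A : SingleArm K) (h : ℝ) (s : BState K) (i : ℕ) : ℝ :=
  A.passiveReward s.1 (s.2 + i) - h

/-- The sum of the positive parts of the surpluses over the level `h`, from state `s` on: the value
of staying passive and stopping when the reward falls below `h`. -/
noncomputable def totalSurplus (A : SingleArm K) (h : ℝ) (s : BState K) : ℝ :=
  ∑' i, (A.surplus h s i)⁺

/-- The total surplus over the level `h` is finite in every state. -/
def SummableSurplus (A : SingleArm K) (h : ℝ) : Prop :=
  ∀ s : BState K, Summable fun i => (A.surplus h s i)⁺

/-- The value of the active action for the relative value function `V`. -/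
def restartValue (A : SingleArm K) (V : BState K → ℝ) : ℝ := A.R1 + ∑ k, A.ps k * V (k, 1)

/-- What is gained in state `s` over taking the active action there, according to the relative
value function `V` and the optimal average reward `g`. -/
def advantage (A : SingleArm K) (g : ℝ) (V : BState K → ℝ) (s : BState K) : ℝ :=
  V s + g - A.restartValue V

/-- The subsidy for which the total surplus over the level `h` solves the optimality equation; the
optimal average reward is then `h` plus the subsidy. -/
noncomputable def levelSubsidy (A : SingleArm K) (h : ℝ) : ℝ :=
  A.restartValue (A.totalSurplus h) - h

theorem surplus_zero (A : SingleArm K) (h : ℝ) (s : BState K) :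
    A.surplus h s 0 = A.passiveReward s.1 s.2 - h := rfl

theorem surplus_passiveNext (A : SingleArm K) (h : ℝ) (s : BState K) (i : ℕ) :
    A.surplus h (passiveNext s) i = A.surplus h s (i + 1) := by
  simp only [surplus, passiveNext, PNat.add_coe, PNat.one_coe, add_assoc, add_comm 1 i]

theorem surplus_passiveNext_iterate (A : SingleArm K) (h : ℝ) (s : BState K) (n i : ℕ) :
    A.surplus h (passiveNext^[n] s) i = A.surplus h s (i + n) := by
  induction n generalizing i with
  | zero => rfl
  | succ n ih =>
    rw [Function.iterate_succ_apply', surplus_passiveNext, ih, add_right_comm, add_assoc]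

theorem antitone_surplus (hR : ∀ k, AntitoneOn (A.passiveReward k) (Set.Ici 1)) (h : ℝ)
    (s : BState K) : Antitone (A.surplus h s) := by
  have hmem : ∀ i, (s.2 : ℕ) + i ∈ Set.Ici 1 := fun i => Nat.le_add_right_of_le s.2.pos
  exact fun i j hij => sub_le_sub_right (hR s.1 (hmem i) (hmem j) (Nat.add_le_add_left hij _)) h

theorem posPart_surplus_antitone (A : SingleArm K) (s : BState K) (i : ℕ) :
    Antitone fun h => (A.surplus h s i)⁺ := fun _ _ hh =>
  posPart_mono (sub_le_sub_left hh _)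

theorem totalSurplus_nonneg (A : SingleArm K) (h : ℝ) (s : BState K) : 0 ≤ A.totalSurplus h s :=
  tsum_nonneg fun _ => posPart_nonneg _

theorem totalSurplus_eq_zero (hR : ∀ k, AntitoneOn (A.passiveReward k) (Set.Ici 1))
    (hs : A.passiveReward s.1 s.2 ≤ h) : A.totalSurplus h s = 0 := by
  have hzero : ∀ i, (A.surplus h s i)⁺ = 0 := fun i =>
    posPart_eq_zero.2 ((antitone_surplus hR h s i.zero_le).trans (sub_nonpos.2 hs))
  simp only [totalSurplus, hzero, tsum_zero]

theorem restartValue_mono (A : SingleArm K) {V V' : BState K → ℝ}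
    (hV : ∀ k, V (k, 1) ≤ V' (k, 1)) : A.restartValue V ≤ A.restartValue V' :=
  add_le_add_right
    (Finset.sum_le_sum fun k _ => mul_le_mul_of_nonneg_left (hV k) (A.ps_nonneg k)) _

namespace SummableSurplus

theorem mono (hs : A.SummableSurplus h) (hh : h ≤ h') : A.SummableSurplus h' := fun s =>
  (hs s).of_nonneg_of_le (fun _ => posPart_nonneg _) fun i => A.posPart_surplus_antitone s i hh

theorem levelSubsidy_le (hs : A.SummableSurplus h) (hh : h ≤ h') :
    A.levelSubsidy h' ≤ A.levelSubsidy h :=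
  sub_le_sub (A.restartValue_mono fun k => ((hs.mono hh) (k, 1)).tsum_le_tsum
    (fun i => A.posPart_surplus_antitone (k, 1) i hh) (hs (k, 1))) hh

theorem totalSurplus_eq (hs : A.SummableSurplus h)
    (hR : ∀ k, AntitoneOn (A.passiveReward k) (Set.Ici 1)) (s : BState K) :
    A.totalSurplus h s =
      (A.passiveReward s.1 s.2 - h + A.totalSurplus h (passiveNext s))⁺ := by
  simpa only [totalSurplus, surplus_passiveNext, surplus_zero] using
    tsum_posPart_eq_posPart_add (antitone_surplus hR h s) (hs s)

theorem totalSurplus_passiveNext_le (hs : A.SummableSurplus h) (s : BState K) :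
    A.totalSurplus h (passiveNext s) ≤ A.totalSurplus h s := by
  simp only [totalSurplus, surplus_passiveNext]
  rw [(hs s).tsum_eq_zero_add]
  exact le_add_of_nonneg_left (posPart_nonneg _)

theorem totalSurplus_le_one (hs : A.SummableSurplus h) (k : Fin K) (τ : ℕ+) :
    A.totalSurplus h (k, τ) ≤ A.totalSurplus h (k, 1) := by
  induction τ using PNat.recOn with
  | one => exact le_rfl
  | succ τ ih => exact (hs.totalSurplus_passiveNext_le (k, τ)).trans ih

theorem abs_totalSurplus_le (hs : A.SummableSurplus h) (s : BState K) :
    |A.totalSurplus h s| ≤ ∑ k, A.totalSurplus h (k, 1) := by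
  rw [abs_of_nonneg (A.totalSurplus_nonneg h s)]
  exact (hs.totalSurplus_le_one s.1 s.2).trans (Finset.single_le_sum
    (f := fun k => A.totalSurplus h (k, 1)) (fun k _ => A.totalSurplus_nonneg h (k, 1))
    (Finset.mem_univ s.1))

end SummableSurplus

theorem actionValue_false (A : SingleArm K) (W : ℝ) (V : BState K → ℝ) (s : BState K) :
    A.actionValue W V false s = A.passiveReward s.1 s.2 + W + V (passiveNext s) := by
  simp [actionValue, reward, expNext_passive, passiveNext]

theorem actionValue_true (A : SingleArm K) (W : ℝ) (V : BState K → ℝ) (s : BState K) :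
    A.actionValue W V true s = A.restartValue V := by
  simp [actionValue, reward, expNext_active, restartValue]

theorem passive_sub_active (A : SingleArm K) (W g : ℝ) (V : BState K → ℝ) (s : BState K) :
    A.actionValue W V false s - A.actionValue W V true s =
      A.passiveReward s.1 s.2 - (g - W) + A.advantage g V (passiveNext s) := by
  rw [actionValue_false, actionValue_true, advantage]
  ring

theorem optimalityEquation_iff (A : SingleArm K) (W g : ℝ) (V : BState K → ℝ) (s : BState K) :
    V s + g = max (A.actionValue W V false s) (A.actionValue W V true s) ↔
      A.advantage g V s =
        (A.passiveReward s.1 s.2 - (g - W) + A.advantage g V (passiveNext s))⁺ := by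
  rw [← A.passive_sub_active, posPart_def, ← sub_self (A.actionValue W V true s),
    max_sub_sub_right, advantage, ← A.actionValue_true W V s, sub_left_inj]

theorem SummableSurplus.solvesOptimality (hs : A.SummableSurplus h)
    (hR : ∀ k, AntitoneOn (A.passiveReward k) (Set.Ici 1)) :
    A.SolvesOptimality (A.levelSubsidy h) (A.levelSubsidy h + h) (A.totalSurplus h) := by
  have hadv : A.advantage (A.levelSubsidy h + h) (A.totalSurplus h) = A.totalSurplus h := by
    funext s
    simp [advantage, levelSubsidy]
  have hV : ∀ s, A.totalSurplus h s + (A.levelSubsidy h + h) =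
      max (A.actionValue (A.levelSubsidy h) (A.totalSurplus h) false s)
        (A.actionValue (A.levelSubsidy h) (A.totalSurplus h) true s) := fun s => by
    rw [optimalityEquation_iff, hadv, add_sub_cancel_left]
    exact hs.totalSurplus_eq hR s
  exact ⟨A.optAvgReward_eq hs.abs_totalSurplus_le hV, ⟨_, hs.abs_totalSurplus_le⟩, hV⟩

theorem SummableSurplus.indifferent (hs : A.SummableSurplus (A.passiveReward s.1 s.2))
    (hR : ∀ k, AntitoneOn (A.passiveReward k) (Set.Ici 1)) :
    A.Indifferent (A.levelSubsidy (A.passiveReward s.1 s.2)) s := by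
  have hzero : A.totalSurplus (A.passiveReward s.1 s.2) (passiveNext s) = 0 :=
    le_antisymm ((hs.totalSurplus_passiveNext_le s).trans_eq (totalSurplus_eq_zero hR le_rfl))
      (A.totalSurplus_nonneg _ _)
  refine ⟨_, _, hs.solvesOptimality hR, ?_⟩
  rw [actionValue_false, actionValue_true, hzero, levelSubsidy]
  ring

namespace SolvesOptimality

theorem advantage_eq (hV : A.SolvesOptimality W g V) (s : BState K) :
    A.advantage g V s =
      (A.passiveReward s.1 s.2 - (g - W) + A.advantage g V (passiveNext s))⁺ :=
  (A.optimalityEquation_iff W g V s).1 (hV.2.2 s)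

theorem advantage_iterate_eq (hV : A.SolvesOptimality W g V) (s : BState K) (n : ℕ) :
    A.advantage g V (passiveNext^[n] s) =
      (A.surplus (g - W) s n + A.advantage g V (passiveNext^[n + 1] s))⁺ := by
  rw [hV.advantage_eq, ← surplus_zero, surplus_passiveNext_iterate, zero_add,
    Function.iterate_succ_apply']

theorem bddAbove_advantage (hV : A.SolvesOptimality W g V) :
    BddAbove (Set.range (A.advantage g V)) := by
  obtain ⟨C, hC⟩ := hV.2.1
  refine ⟨C + g - A.restartValue V, ?_⟩
  rintro _ ⟨s, rfl⟩
  exact sub_le_sub_right (add_le_add_left (le_of_abs_le (hC s)) g) _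

theorem sum_posPart_surplus_le (hV : A.SolvesOptimality W g V)
    (hR : ∀ k, AntitoneOn (A.passiveReward k) (Set.Ici 1)) (s : BState K) (m : ℕ) :
    ∑ i ∈ Finset.range m, (A.surplus (g - W) s i)⁺ ≤ A.advantage g V s :=
  sum_range_posPart_le (U := fun n => A.advantage g V (passiveNext^[n] s))
    (antitone_surplus hR _ s)
    (fun n => (hV.advantage_iterate_eq s n).symm ▸ posPart_nonneg _)
    (fun n => (hV.advantage_iterate_eq s n).symm ▸ le_posPart _) m

theorem summableSurplus (hV : A.SolvesOptimality W g V)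
    (hR : ∀ k, AntitoneOn (A.passiveReward k) (Set.Ici 1)) : A.SummableSurplus (g - W) := fun s =>
  summable_of_sum_range_le (fun _ => posPart_nonneg _) (hV.sum_posPart_surplus_le hR s)

theorem levelSubsidy_le (hV : A.SolvesOptimality W g V)
    (hR : ∀ k, AntitoneOn (A.passiveReward k) (Set.Ici 1)) : A.levelSubsidy (g - W) ≤ W := by
  have hrestart : A.restartValue (A.advantage g V) = g := by
    simp only [advantage, restartValue, mul_sub, mul_add, Finset.sum_sub_distrib,
      Finset.sum_add_distrib, ← Finset.sum_mul, A.ps_sum]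
    ring
  have hle : A.restartValue (A.totalSurplus (g - W)) ≤ g :=
    (A.restartValue_mono fun k => Real.tsum_le_of_sum_range_le (fun _ => posPart_nonneg _)
      (hV.sum_posPart_surplus_le hR (k, 1))).trans_eq hrestart
  rw [levelSubsidy]
  linarith

theorem passiveReward_eq (hV : A.SolvesOptimality W g V)
    (hR : ∀ k, AntitoneOn (A.passiveReward k) (Set.Ici 1))
    (hs : A.actionValue W V false s = A.actionValue W V true s) :
    A.passiveReward s.1 s.2 = g - W := by
  refine sub_eq_zero.1 (eq_zero_of_add_eq_zero_of_posPart_eq (antitone_surplus hR (g - W) s)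
    (hV.bddAbove_advantage.mono (Set.range_comp_subset_range (fun n => passiveNext^[n] s) _))
    (hV.advantage_iterate_eq s) ?_)
  exact (A.passive_sub_active W g V s).symm.trans (sub_eq_zero.2 hs)

end SolvesOptimality

theorem Indifferent.summableSurplus (hs : A.Indifferent W s)
    (hR : ∀ k, AntitoneOn (A.passiveReward k) (Set.Ici 1)) :
    A.SummableSurplus (A.passiveReward s.1 s.2) := by
  obtain ⟨g, V, hV, heq⟩ := hs
  exact hV.passiveReward_eq hR heq ▸ hV.summableSurplus hR

theorem Indifferent.levelSubsidy_le (hs : A.Indifferent W s)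
    (hR : ∀ k, AntitoneOn (A.passiveReward k) (Set.Ici 1)) :
    A.levelSubsidy (A.passiveReward s.1 s.2) ≤ W := by
  obtain ⟨g, V, hV, heq⟩ := hs
  exact hV.passiveReward_eq hR heq ▸ hV.levelSubsidy_le hR

theorem SummableSurplus.isLeast_indifferent (hs : A.SummableSurplus (A.passiveReward s.1 s.2))
    (hR : ∀ k, AntitoneOn (A.passiveReward k) (Set.Ici 1)) :
    IsLeast {W : ℝ | A.Indifferent W s} (A.levelSubsidy (A.passiveReward s.1 s.2)) :=
  ⟨hs.indifferent hR, fun _ hW => hW.levelSubsidy_le hR⟩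

theorem whittleIndex_eq_of_isLeast (hW : IsLeast {W : ℝ | A.Indifferent W s} W) :
    A.whittleIndex s = W :=
  (EReal.coe_strictMono.monotone.map_isLeast hW).csInf_eq

theorem monotone_whittleIndex (hR : ∀ k, AntitoneOn (A.passiveReward k) (Set.Ici 1))
    (k : Fin K) : Monotone fun τ : ℕ+ => A.whittleIndex (k, τ) := by
  intro τ τ' hτ
  refine le_sInf ?_
  rintro _ ⟨W, hW, rfl⟩
  have hle : A.passiveReward k τ' ≤ A.passiveReward k τ := hR k τ.pos τ'.pos hτ
  have hs' := hW.summableSurplus hR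
  have hs : A.SummableSurplus (A.passiveReward k τ) := hs'.mono hle
  refine (whittleIndex_eq_of_isLeast (hs.isLeast_indifferent (s := (k, τ)) hR)).trans_le ?_
  exact EReal.coe_le_coe ((hs'.levelSubsidy_le hle).trans (hW.levelSubsidy_le hR))

end OptimalStopping

section Cycles

variable {K : ℕ} {A : SingleArm K} {Γ Γ' : Fin K → ℕ} {h : ℝ}

/-- The mean length of a cycle of the threshold policy `Γ`: the slots after an active slot up to
the next active slot. -/
noncomputable def cycleLength (A : SingleArm K) (Γ : Fin K → ℕ) : ℝ :=
  ∑ k, ((Γ k : ℝ) + 1) * A.ps k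

/-- The mean reward, without subsidy, that the threshold policy `Γ` collects in a cycle. -/
noncomputable def cycleReward (A : SingleArm K) (Γ : Fin K → ℕ) : ℝ :=
  A.R1 + ∑ k, ∑ r ∈ Finset.Icc 1 (Γ k), A.passiveReward k r * A.ps k

theorem closedForm_eq (A : SingleArm K) (Γ : Fin K → ℕ) (v : Fin K) (τ : ℕ) :
    A.closedForm Γ v τ = A.cycleReward Γ - A.passiveReward v τ * A.cycleLength Γ := rfl

theorem cycleLength_eq_add_one (A : SingleArm K) (Γ : Fin K → ℕ) :
    A.cycleLength Γ = ∑ k, (Γ k : ℝ) * A.ps k + 1 := by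
  simp only [cycleLength, add_mul, one_mul, Finset.sum_add_distrib, A.ps_sum]

theorem cycleLength_pos (A : SingleArm K) (Γ : Fin K → ℕ) : 0 < A.cycleLength Γ := by
  rw [cycleLength_eq_add_one]
  exact add_pos_of_nonneg_of_pos
    (Finset.sum_nonneg fun k _ => mul_nonneg (Nat.cast_nonneg _) (A.ps_nonneg k)) one_pos

theorem cycleLength_strictMono (hps : ∀ k, 0 < A.ps k) : StrictMono A.cycleLength := by
  intro Γ Γ' hlt
  obtain ⟨hle, k, hk⟩ := Pi.lt_def.1 hlt
  refine Finset.sum_lt_sum (fun i _ => ?_) ⟨k, Finset.mem_univ k, ?_⟩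
  · have := hle i
    have := A.ps_nonneg i
    gcongr
  · have := hps k
    gcongr

theorem cycleLength_add_single (A : SingleArm K) (Γ : Fin K → ℕ) (v : Fin K) :
    A.cycleLength (Γ + Pi.single v 1) = A.cycleLength Γ + A.ps v := by
  simp [cycleLength_eq_add_one, add_mul, Finset.sum_add_distrib, Pi.single_apply, add_right_comm]

theorem cycleReward_add_single (A : SingleArm K) (Γ : Fin K → ℕ) (v : Fin K) :
    A.cycleReward (Γ + Pi.single v 1) =
      A.cycleReward Γ + A.passiveReward v (Γ v + 1) * A.ps v := by
  have hsplit : ∀ k, ∑ r ∈ Finset.Icc 1 ((Γ + Pi.single v 1 : Fin K → ℕ) k),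
      A.passiveReward k r * A.ps k =
      ∑ r ∈ Finset.Icc 1 (Γ k), A.passiveReward k r * A.ps k +
        if k = v then A.passiveReward v (Γ v + 1) * A.ps v else 0 := by
    intro k
    rcases eq_or_ne k v with rfl | hk
    · simp [Finset.sum_Icc_succ_top]
    · simp [hk]
  simp only [cycleReward, hsplit, Finset.sum_add_distrib, Finset.sum_ite_eq', Finset.mem_univ,
    if_true, add_assoc]

theorem passiveReward_le_of_lt (hR : ∀ k, AntitoneOn (A.passiveReward k) (Set.Ici 1))
    (hh : ∀ k, A.passiveReward k (Γ k + 1) ≤ h) {k : Fin K} {r : ℕ} (hr : Γ k < r) :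
    A.passiveReward k r ≤ h :=
  (hR k (Nat.le_add_left 1 _) (Nat.one_le_of_lt hr) hr).trans (hh k)

theorem cycleReward_sub_le (hR : ∀ k, AntitoneOn (A.passiveReward k) (Set.Ici 1)) (hle : Γ ≤ Γ')
    (hh : ∀ k, A.passiveReward k (Γ k + 1) ≤ h) :
    A.cycleReward Γ' - A.cycleReward Γ ≤ h * (A.cycleLength Γ' - A.cycleLength Γ) := by
  have hchannel : ∀ k, ∑ r ∈ Finset.Icc 1 (Γ' k), A.passiveReward k r * A.ps k -
      ∑ r ∈ Finset.Icc 1 (Γ k), A.passiveReward k r * A.ps k ≤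
        h * ((Γ' k : ℝ) * A.ps k - (Γ k : ℝ) * A.ps k) := by
    intro k
    have hsum := Finset.sum_le_card_nsmul (Finset.Ioc (Γ k) (Γ' k))
      (fun r => A.passiveReward k r * A.ps k) (h * A.ps k) fun r hr =>
        mul_le_mul_of_nonneg_right (passiveReward_le_of_lt hR hh (Finset.mem_Ioc.1 hr).1)
          (A.ps_nonneg k)
    have hsplit := Finset.sum_Ioc_consecutive (fun r => A.passiveReward k r * A.ps k)
      (Nat.zero_le (Γ k)) (hle k)
    simp only [← Finset.Icc_add_one_left_eq_Ioc 0, zero_add] at hsplit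
    rw [Nat.card_Ioc, nsmul_eq_mul, Nat.cast_sub (hle k)] at hsum
    linarith
  have hsum := Finset.sum_le_sum fun k (_ : k ∈ Finset.univ) => hchannel k
  rw [← Finset.mul_sum, Finset.sum_sub_distrib, Finset.sum_sub_distrib] at hsum
  simpa only [cycleReward, cycleLength_eq_add_one, add_sub_add_left_eq_sub,
    add_sub_add_right_eq_sub] using hsum

end Cycles

section SeparatingThresholds

variable {K : ℕ} {A : SingleArm K} {Γ : Fin K → ℕ} {v : Fin K} {h : ℝ}

/-- The threshold vector `Γ` separates the passive rewards at the level `h`: those that the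
threshold policy `Γ` collects are at least `h`, the others are at most `h`. -/
def Separates (A : SingleArm K) (Γ : Fin K → ℕ) (h : ℝ) : Prop :=
  ∀ k, (∀ r ∈ Finset.Icc 1 (Γ k), h ≤ A.passiveReward k r) ∧
    ∀ r, Γ k < r → A.passiveReward k r ≤ h

namespace Separates

theorem summableSurplus (hsep : A.Separates Γ h) : A.SummableSurplus h := fun s =>
  summable_of_ne_finset_zero (s := Finset.range (Γ s.1)) fun i hi => by
    have hlt : Γ s.1 < s.2 + i := by
      have := s.2.pos
      have := Finset.mem_range.not.1 hi
      omega
    exact posPart_eq_zero.2 (sub_nonpos.2 ((hsep s.1).2 _ hlt))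

theorem totalSurplus_one (hsep : A.Separates Γ h) (k : Fin K) :
    A.totalSurplus h (k, 1) = ∑ r ∈ Finset.Icc 1 (Γ k), (A.passiveReward k r - h) := by
  rw [totalSurplus, tsum_eq_sum (s := Finset.range (Γ k)), ← Finset.Ico_add_one_right_eq_Icc,
    Finset.sum_Ico_eq_sum_range, Nat.add_sub_cancel]
  · refine Finset.sum_congr rfl fun i hi => posPart_of_nonneg (sub_nonneg.2 ?_)
    have := Finset.mem_range.1 hi
    exact (hsep k).1 _ (Finset.mem_Icc.2 ⟨Nat.le_add_right _ _, by simp; omega⟩)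
  · intro i hi
    have := Finset.mem_range.not.1 hi
    exact posPart_eq_zero.2 (sub_nonpos.2 ((hsep k).2 _ (by simp; omega)))

theorem levelSubsidy_eq (hsep : A.Separates Γ h) :
    A.levelSubsidy h = A.cycleReward Γ - h * A.cycleLength Γ := by
  have hchannel : ∀ k, A.ps k * A.totalSurplus h (k, 1) =
      ∑ r ∈ Finset.Icc 1 (Γ k), A.passiveReward k r * A.ps k - h * ((Γ k : ℝ) * A.ps k) := by
    intro k
    rw [hsep.totalSurplus_one, Finset.sum_sub_distrib, Finset.sum_const, Nat.card_Icc,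
      Nat.add_sub_cancel, nsmul_eq_mul, ← Finset.sum_mul]
    ring
  simp only [levelSubsidy, restartValue, hchannel, Finset.sum_sub_distrib, ← Finset.mul_sum,
    cycleReward, cycleLength_eq_add_one]
  ring

theorem isLeast_indifferent {τ : ℕ+} (hsep : A.Separates Γ (A.passiveReward v τ))
    (hR : ∀ k, AntitoneOn (A.passiveReward k) (Set.Ici 1)) :
    IsLeast {W : ℝ | A.Indifferent W (v, τ)} (A.closedForm Γ v τ) := by
  rw [closedForm_eq, ← hsep.levelSubsidy_eq]
  exact hsep.summableSurplus.isLeast_indifferent (s := (v, τ)) hR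

end Separates

theorem countBefore_succ (u : ℕ → Fin K) (n : ℕ) :
    countBefore u (n + 1) = countBefore u n + Pi.single (u n) 1 := by
  funext k
  rcases eq_or_ne (u n) k with rfl | hk
  · simp [countBefore, Finset.range_add_one, Finset.filter_insert]
  · simp [countBefore, Finset.range_add_one, Finset.filter_insert, hk, hk.symm]

theorem countBefore_succ_self (u : ℕ → Fin K) (n : ℕ) :
    countBefore u (n + 1) (u n) = countBefore u n (u n) + 1 := by
  simp [countBefore_succ]

theorem IsGreedy.separates {u : ℕ → Fin K} (hu : A.IsGreedy u)
    (hR : ∀ k, AntitoneOn (A.passiveReward k) (Set.Ici 1)) (j : ℕ) :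
    A.Separates (countBefore u j)
      (A.passiveReward (u j) (countBefore u (j + 1) (u j))) := by
  induction j with
  | zero =>
    rw [countBefore_succ_self]
    exact fun k => ⟨by simp [countBefore], fun r => passiveReward_le_of_lt hR (hu 0)⟩
  | succ j ih =>
    rw [countBefore_succ_self u (j + 1)]
    refine fun k => ⟨fun r hr => ?_, fun r => passiveReward_le_of_lt hR (hu (j + 1))⟩
    have hlevel : A.passiveReward (u (j + 1)) (countBefore u (j + 1) (u (j + 1)) + 1) ≤
        A.passiveReward (u j) (countBefore u (j + 1) (u j)) := by
      refine (ih _).2 _ ?_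
      rw [countBefore_succ, Pi.add_apply]
      omega
    refine hlevel.trans ?_
    obtain ⟨h1r, hr⟩ := Finset.mem_Icc.1 hr
    rcases le_or_gt r (countBefore u j k) with hle | hlt
    · exact (ih k).1 r (Finset.mem_Icc.2 ⟨h1r, hle⟩)
    · rcases eq_or_ne k (u j) with rfl | hk
      · rw [countBefore_succ_self] at hr ⊢
        rw [le_antisymm hr hlt]
      · simp only [countBefore_succ, Pi.add_apply, Pi.single_eq_of_ne hk] at hr
        omega

end SeparatingThresholds

section SteadyState

variable {K : ℕ} {A : SingleArm K} {Γ : Fin K → ℕ} {α : BState K → ℝ}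

/-- The steady-state law of the threshold policy `Γ`: each state `(k, τ)` with `τ ≤ Γ k + 1` is
visited once per cycle if the channel was observed in state `k`. -/
noncomputable def thresholdLaw (A : SingleArm K) (Γ : Fin K → ℕ) (s : BState K) : ℝ :=
  if (s.2 : ℕ) ≤ Γ s.1 + 1 then A.ps s.1 / A.cycleLength Γ else 0

theorem thresholdLaw_nonneg (A : SingleArm K) (Γ : Fin K → ℕ) (s : BState K) :
    0 ≤ A.thresholdLaw Γ s := by
  rw [thresholdLaw]
  split_ifs
  exacts [div_nonneg (A.ps_nonneg _) (A.cycleLength_pos Γ).le, le_rfl]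

theorem thresholdLaw_one (A : SingleArm K) (Γ : Fin K → ℕ) (k : Fin K) :
    A.thresholdLaw Γ (k, 1) = A.ps k / A.cycleLength Γ := by
  simp [thresholdLaw]

theorem thresholdLaw_add_one (A : SingleArm K) (Γ : Fin K → ℕ) (k : Fin K) (τ : ℕ+) :
    A.thresholdLaw Γ (k, τ + 1) = if (τ : ℕ) ≤ Γ k then A.thresholdLaw Γ (k, τ) else 0 := by
  simp only [thresholdLaw, PNat.add_coe, PNat.one_coe, add_le_add_iff_right]
  split_ifs <;> first | rfl | omega

theorem thresholdLaw_succPNat (A : SingleArm K) {k : Fin K} {r : ℕ} (hr : r ≤ Γ k) :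
    A.thresholdLaw Γ (k, r.succPNat) = A.ps k / A.cycleLength Γ :=
  if_pos (Nat.succ_le_succ hr)

theorem hasSum_thresholdLaw_mul (A : SingleArm K) (Γ : Fin K → ℕ) (f : Bool → BState K → ℝ) :
    HasSum (fun s => A.thresholdLaw Γ s * f (thresholdPolicy Γ s) s)
      ((∑ k, A.ps k * (∑ r ∈ Finset.range (Γ k), f false (k, r.succPNat) +
        f true (k, (Γ k).succPNat))) / A.cycleLength Γ) := by
  convert hasSum_prod_pnat_of_eq_zero (N := fun k => Γ k + 1)
    (f := fun s => A.thresholdLaw Γ s * f (thresholdPolicy Γ s) s) ?_ using 1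
  · rw [Finset.sum_div]
    refine Finset.sum_congr rfl fun k _ => ?_
    have hpassive : ∀ r ∈ Finset.range (Γ k), A.thresholdLaw Γ (k, r.succPNat) *
        f (thresholdPolicy Γ (k, r.succPNat)) (k, r.succPNat) =
          A.ps k / A.cycleLength Γ * f false (k, r.succPNat) := by
      intro r hr
      have hr' : r < Γ k := Finset.mem_range.1 hr
      rw [thresholdLaw_succPNat A hr'.le, thresholdPolicy, decide_eq_false]
      exact not_lt.2 hr'
    have hactive : thresholdPolicy Γ (k, (Γ k).succPNat) = true :=
      decide_eq_true (Nat.lt_succ_self _)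
    rw [Finset.sum_range_succ, Finset.sum_congr rfl hpassive, hactive,
      thresholdLaw_succPNat A le_rfl, ← Finset.mul_sum]
    ring
  · intro k r hr
    have hlaw : A.thresholdLaw Γ (k, r.succPNat) = 0 :=
      if_neg (not_le.2 (Nat.lt_succ_of_le hr))
    rw [hlaw, zero_mul]

theorem q_one (A : SingleArm K) (a : Bool) (s : BState K) (k : Fin K) :
    A.q a s (k, 1) = if a then A.ps k else 0 := by
  have hne : (k, 1) ≠ ((s.1, s.2 + 1) : BState K) := fun h =>
    (PNat.lt_add_left 1 s.2).ne (congrArg Prod.snd h)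
  simp [q, hne]

theorem q_add_one (A : SingleArm K) (a : Bool) (s : BState K) (k : Fin K) (τ : ℕ+) :
    A.q a s (k, τ + 1) = if a then 0 else if s = (k, τ) then 1 else 0 := by
  have hne : τ + 1 ≠ 1 := (PNat.lt_add_left 1 τ).ne'
  simp [q, hne, Prod.ext_iff, eq_comm]

theorem hasSum_flow_add_one (A : SingleArm K) (Γ : Fin K → ℕ) (α : BState K → ℝ) (k : Fin K)
    (τ : ℕ+) :
    HasSum (fun s => α s * A.q (thresholdPolicy Γ s) s (k, τ + 1))
      (if (τ : ℕ) ≤ Γ k then α (k, τ) else 0) := by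
  convert hasSum_single (k, τ) ?_ using 1
  · by_cases h : (τ : ℕ) ≤ Γ k
    · simp [q_add_one, thresholdPolicy, h, not_lt.2 h]
    · simp [q_add_one, thresholdPolicy, h, not_le.1 h]
  · intro s hs
    simp [q_add_one, hs]

theorem hasSum_thresholdLaw (A : SingleArm K) (Γ : Fin K → ℕ) : HasSum (A.thresholdLaw Γ) 1 := by
  have hsum := A.hasSum_thresholdLaw_mul Γ fun _ _ => 1
  simp only [mul_one, Finset.sum_const, Finset.card_range, nsmul_eq_mul] at hsum
  simp only [mul_comm (A.ps _)] at hsum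
  rwa [← cycleLength, div_self (A.cycleLength_pos Γ).ne'] at hsum

theorem isSteadyState_thresholdLaw (A : SingleArm K) (Γ : Fin K → ℕ) :
    A.IsSteadyState Γ (A.thresholdLaw Γ) := by
  refine ⟨A.thresholdLaw_nonneg Γ, A.hasSum_thresholdLaw Γ, ?_⟩
  rintro ⟨k, τ⟩
  induction τ using PNat.recOn with
  | one =>
    have hsum := A.hasSum_thresholdLaw_mul Γ fun a s => A.q a s (k, 1)
    simpa [q_one, ← Finset.sum_mul, A.ps_sum, ← thresholdLaw_one] using hsum
  | succ τ _ =>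
    rw [thresholdLaw_add_one]
    exact A.hasSum_flow_add_one Γ _ k τ

namespace IsSteadyState

theorem exists_apply_one (hα : A.IsSteadyState Γ α) : ∃ p, ∀ k, α (k, 1) = p * A.ps k := by
  obtain ⟨h0, h1, hflow⟩ := hα
  have hactive : Summable fun s => if thresholdPolicy Γ s then α s else 0 :=
    h1.summable.of_nonneg_of_le (fun s => by split_ifs <;> simp [h0 s])
      fun s => by split_ifs <;> simp [h0 s]
  refine ⟨∑' s, if thresholdPolicy Γ s then α s else 0, fun k => (hflow (k, 1)).unique ?_⟩
  simpa only [q_one, mul_ite, ite_mul, mul_zero, zero_mul] using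
    hactive.hasSum.mul_right (A.ps k)

theorem apply_add_one (hα : A.IsSteadyState Γ α) (k : Fin K) (τ : ℕ+) :
    α (k, τ + 1) = if (τ : ℕ) ≤ Γ k then α (k, τ) else 0 :=
  (hα.2.2 (k, τ + 1)).unique (A.hasSum_flow_add_one Γ α k τ)

theorem eq_thresholdLaw (hα : A.IsSteadyState Γ α) : α = A.thresholdLaw Γ := by
  obtain ⟨p, hp⟩ := hα.exists_apply_one
  have hmul : ∀ s, α s = p * A.cycleLength Γ * A.thresholdLaw Γ s := by
    rintro ⟨k, τ⟩
    induction τ using PNat.recOn with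
    | one =>
      rw [hp, thresholdLaw_one, mul_assoc, mul_div_cancel₀ _ (A.cycleLength_pos Γ).ne']
    | succ τ ih => rw [hα.apply_add_one, thresholdLaw_add_one, ih, mul_ite, mul_zero]
  have hone : p * A.cycleLength Γ = 1 := by
    have hsum := (A.hasSum_thresholdLaw Γ).mul_left (p * A.cycleLength Γ)
    simp only [← hmul, mul_one] at hsum
    exact hsum.unique hα.2.1
  funext s
  rw [hmul, hone, one_mul]

end IsSteadyState

theorem existsUnique_isSteadyState (A : SingleArm K) (Γ : Fin K → ℕ) :
    ∃! α : BState K → ℝ, A.IsSteadyState Γ α :=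
  ⟨_, A.isSteadyState_thresholdLaw Γ, fun _ hα => hα.eq_thresholdLaw⟩

theorem meanReward_thresholdLaw (A : SingleArm K) (Γ : Fin K → ℕ) :
    A.meanReward Γ (A.thresholdLaw Γ) = A.cycleReward Γ / A.cycleLength Γ := by
  refine (A.hasSum_thresholdLaw_mul Γ (A.reward 0)).tsum_eq.trans ?_
  have hchannel : ∀ k, ∑ r ∈ Finset.Icc 1 (Γ k), A.passiveReward k r * A.ps k =
      A.ps k * ∑ r ∈ Finset.range (Γ k), A.passiveReward k (r + 1) := by
    intro k
    rw [← Finset.sum_mul, ← Finset.Ico_add_one_right_eq_Icc, Finset.sum_Ico_eq_sum_range,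
      Nat.add_sub_cancel, mul_comm]
    simp only [add_comm 1]
  simp [reward, cycleReward, hchannel, mul_add, Finset.sum_add_distrib, ← Finset.sum_mul,
    A.ps_sum, add_comm]

theorem passiveProb_thresholdLaw (A : SingleArm K) (Γ : Fin K → ℕ) :
    passiveProb Γ (A.thresholdLaw Γ) = 1 - 1 / A.cycleLength Γ := by
  have hchannel : ∀ k, ∑ r ∈ Finset.range (Γ k), A.thresholdLaw Γ (k, r.succPNat) =
      (Γ k : ℝ) * A.ps k / A.cycleLength Γ := by
    intro k
    rw [Finset.sum_congr rfl fun r hr => thresholdLaw_succPNat A (Finset.mem_range.1 hr).le,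
      Finset.sum_const, Finset.card_range, nsmul_eq_mul, mul_div_assoc]
  rw [passiveProb, Finset.sum_congr rfl fun k _ => hchannel k, ← Finset.sum_div,
    eq_sub_of_add_eq (A.cycleLength_eq_add_one Γ).symm, sub_div,
    div_self (A.cycleLength_pos Γ).ne']

end SteadyState

section StepValues

variable {K : ℕ} {A : SingleArm K} {Γ Γ' : Fin K → ℕ} {v : Fin K} {h : ℝ}

theorem stepRatio_thresholdLaw (A : SingleArm K)
    (hne : A.cycleLength Γ ≠ A.cycleLength Γ') :
    A.stepRatio A.thresholdLaw Γ Γ' = A.cycleReward Γ -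
      (A.cycleReward Γ' - A.cycleReward Γ) / (A.cycleLength Γ' - A.cycleLength Γ) *
        A.cycleLength Γ := by
  have hL := (A.cycleLength_pos Γ).ne'
  have hL' := (A.cycleLength_pos Γ').ne'
  have hsub : A.cycleLength Γ' - A.cycleLength Γ ≠ 0 := sub_ne_zero.2 hne.symm
  have hD : 1 - 1 / A.cycleLength Γ' - (1 - 1 / A.cycleLength Γ) =
      (A.cycleLength Γ' - A.cycleLength Γ) / (A.cycleLength Γ * A.cycleLength Γ') := by
    field_simp
    ring
  rw [stepRatio, meanReward_thresholdLaw, meanReward_thresholdLaw, passiveProb_thresholdLaw,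
    passiveProb_thresholdLaw, hD]
  field_simp
  ring

theorem stepRatio_add_single (Γ : Fin K → ℕ) (hv : 0 < A.ps v) :
    A.stepRatio A.thresholdLaw Γ (Γ + Pi.single v 1) = A.closedForm Γ v (Γ v + 1) := by
  have hL := A.cycleLength_add_single Γ v
  rw [A.stepRatio_thresholdLaw (by linarith), hL, cycleReward_add_single, add_sub_cancel_left,
    add_sub_cancel_left, mul_div_cancel_right₀ _ hv.ne', closedForm_eq]

theorem sub_mul_le_stepRatio (hR : ∀ k, AntitoneOn (A.passiveReward k) (Set.Ici 1))
    (hps : ∀ k, 0 < A.ps k) (hh : ∀ k, A.passiveReward k (Γ k + 1) ≤ h) (hlt : Γ < Γ') :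
    A.cycleReward Γ - h * A.cycleLength Γ ≤ A.stepRatio A.thresholdLaw Γ Γ' := by
  have hL := cycleLength_strictMono hps hlt
  rw [A.stepRatio_thresholdLaw hL.ne]
  refine sub_le_sub_left (mul_le_mul_of_nonneg_right ?_ (A.cycleLength_pos Γ).le) _
  exact (div_le_iff₀ (sub_pos.2 hL)).2 (cycleReward_sub_le hR hlt.le hh)

theorem isLeast_stepValues (hR : ∀ k, AntitoneOn (A.passiveReward k) (Set.Ici 1))
    (hps : ∀ k, 0 < A.ps k)
    (hv : ∀ k, A.passiveReward k (Γ k + 1) ≤ A.passiveReward v (Γ v + 1)) :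
    IsLeast (A.stepValues A.thresholdLaw Γ) (A.closedForm Γ v (Γ v + 1)) := by
  refine ⟨⟨Γ + Pi.single v 1, ?_, stepRatio_add_single Γ (hps v)⟩, ?_⟩
  · exact lt_add_of_pos_right Γ (Pi.single_pos.2 one_pos)
  · rintro _ ⟨Γ', hlt, rfl⟩
    exact sub_mul_le_stepRatio hR hps hv hlt

end StepValues

end SingleArm

theorem corollary1_general {K : ℕ} (A : SingleArm K)
    (hR : ∀ k, AntitoneOn (A.passiveReward k) (Set.Ici 1))
    (u : ℕ → Fin K) (hu : A.IsGreedy u) :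
    (∀ (j : ℕ) (τ : ℕ+), (τ : ℕ) = SingleArm.countBefore u (j + 1) (u j) →
      IsLeast {W : ℝ | A.Indifferent W (u j, τ)}
        (A.closedForm (SingleArm.countBefore u j) (u j) τ) ∧
      A.whittleIndex (u j, τ) =
        ((A.closedForm (SingleArm.countBefore u j) (u j) τ : ℝ) : EReal)) ∧
    (∀ k : Fin K, Monotone (fun τ : ℕ+ => A.whittleIndex (k, τ))) ∧
    (∀ Γ : Fin K → ℕ, ∃! α : BState K → ℝ, A.IsSteadyState Γ α) ∧
    ((∀ k, 0 < A.ps k) →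
      ∀ α : (Fin K → ℕ) → BState K → ℝ, (∀ Γ, A.IsSteadyState Γ (α Γ)) →
        (∀ Γ Γ' : Fin K → ℕ, Γ < Γ' → ∑ k, Γ' k = (∑ k, Γ k) + 1 →
          IsLeast (A.stepValues α Γ) (A.stepRatio α Γ Γ') →
          ∀ v : Fin K, Γ' v = Γ v + 1 →
            IsLeast (A.stepValues α Γ) (A.closedForm Γ v (Γ' v))) ∧
        (∀ j : ℕ,
          A.stepRatio α (SingleArm.countBefore u j) (SingleArm.countBefore u (j + 1)) =
            A.closedForm (SingleArm.countBefore u j) (u j)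
              (SingleArm.countBefore u (j + 1) (u j)) ∧
          IsLeast (A.stepValues α (SingleArm.countBefore u j))
            (A.closedForm (SingleArm.countBefore u j) (u j)
              (SingleArm.countBefore u (j + 1) (u j))))) := by
  refine ⟨fun j τ hτ => ?_, SingleArm.monotone_whittleIndex hR, A.existsUnique_isSteadyState,
    fun hps α hα => ?_⟩
  · have hleast := SingleArm.Separates.isLeast_indifferent (hτ ▸ hu.separates hR j) hR
    exact ⟨hleast, SingleArm.whittleIndex_eq_of_isLeast hleast⟩
  · obtain rfl : α = A.thresholdLaw := funext fun Γ => (hα Γ).eq_thresholdLaw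
    refine ⟨fun Γ Γ' hlt hsum hmin v hv => ?_, fun j => ?_⟩
    · rw [eq_add_single_of_sum_eq_succ hlt.le hsum hv, SingleArm.stepRatio_add_single Γ (hps v)]
        at hmin
      rwa [hv]
    · rw [SingleArm.countBefore_succ_self, SingleArm.countBefore_succ]
      exact ⟨SingleArm.stepRatio_add_single _ (hps _), SingleArm.isLeast_stepValues hR hps (hu j)⟩

theorem corollary1 {K : ℕ} (A : SingleArm K) (hR : A.RewardMonotone)
    (u : ℕ → Fin K) (hu : A.IsGreedy u) :
    -- the closed form of Whittle's index along the greedy sequence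
    (∀ (j : ℕ) (τ : ℕ+), (τ : ℕ) = SingleArm.countBefore u (j + 1) (u j) →
      IsLeast {W : ℝ | A.Indifferent W (u j, τ)}
        (A.closedForm (SingleArm.countBefore u j) (u j) τ) ∧
      A.whittleIndex (u j, τ) =
        ((A.closedForm (SingleArm.countBefore u j) (u j) τ : ℝ) : EReal)) ∧
    -- Whittle's index is non-decreasing in `τ`
    (∀ k : Fin K, Monotone (fun τ : ℕ+ => A.whittleIndex (k, τ))) ∧
    -- every threshold policy has exactly one steady-state law
    (∀ Γ : Fin K → ℕ, ∃! α : BState K → ℝ, A.IsSteadyState Γ α) ∧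
    -- the values `W_i` of the steps that compute the index
    ((∀ k, 0 < A.ps k) →
      ∀ α : (Fin K → ℕ) → BState K → ℝ, (∀ Γ, A.IsSteadyState Γ (α Γ)) →
        (∀ Γ Γ' : Fin K → ℕ, Γ < Γ' → ∑ k, Γ' k = (∑ k, Γ k) + 1 →
          IsLeast (A.stepValues α Γ) (A.stepRatio α Γ Γ') →
          ∀ v : Fin K, Γ' v = Γ v + 1 →
            IsLeast (A.stepValues α Γ) (A.closedForm Γ v (Γ' v))) ∧
        (∀ j : ℕ,
          A.stepRatio α (SingleArm.countBefore u j) (SingleArm.countBefore u (j + 1)) =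
            A.closedForm (SingleArm.countBefore u j) (u j)
              (SingleArm.countBefore u (j + 1) (u j)) ∧
          IsLeast (A.stepValues α (SingleArm.countBefore u j))
            (A.closedForm (SingleArm.countBefore u j) (u j)
              (SingleArm.countBefore u (j + 1) (u j))))) := by
  exact corollary1_general A (fun k _ hτ _ _ hle => (hR k _ _ hτ hle).2) u hu
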